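/- Let $d\ge 2$, $N_1,\dots,N_d\ge 1$, and let $T\in\mathbb R^{N_1\times\cdots\times N_d}$ be a tensor with $\|T\|_\infty:=\max_{i_1,\dots,i_d}|T(i_1,\dots,i_d)|=\alpha$. For vectors, $u_1\circ\cdots\circ u_d$ is the tensor with entries $u_1(i_1)\cdots u_d(i_d)$; for matrices $U^{(k)}\in\mathbb R^{N_k\times K}$, $U^{(1)}\circ\cdots\circ U^{(d)}$ is the tensor with entries $\sum_{j=1}^K U^{(1)}(i_1,j)\cdots U^{(d)}(i_d,j)$. A unit tensor is an outer product $u_1\circ\cdots\circ u_d$ of vectors of Euclidean norm $1$, and the rank of a tensor is the least $r$ such that it is a sum of $r$ scalar multiples of unit tensors. Put $$T_\pm=\{X\in\{\pm1\}^{N_1\times\cdots\times N_d}:\operatorname{rank}(X)=1\},\qquad \|T\|_M=\inf\{t>0: T\in t\,\mathrm{conv}(T_\pm)\},$$ $$\|T\|_{\max}=\inf\Big\{\prod_{k=1}^d\|U^{(k)}\|_{2,\infty}: K\ge 0,\ U^{(k)}\in\mathbb R^{N_k\times K},\ T=U^{(1)}\circ\cdots\circ U^{(d)}\Big\},\qquad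 \|U\|_{2,\infty}=\sup_{\|x\|_2=1}\|Ux\|_\infty ,$$ where the supremum is read as $0$ if $K=0$. If $T$ has rank $r$, then $$\alpha\le\|T\|_M\le (r\sqrt r)^{d-1}\alpha,\qquad \alpha\le\|T\|_{\max}\le\sqrt{r^{d^2-d}}\,\alpha .$$ (These bounds do not depend on $N_1,\dots,N_d$.) Moreover, there are reals $\sigma_j$ and vectors $u_j^k\in\mathbb R^{N_k}$ with $\|u_j^k\|_\infty=1$ ($1\le j\le r^{d-1}$, $1\le k\le d$) such that $$T=\sum_{j=1}^{r^{d-1}}\sigma_j\,u_j^1\circ\cdots\circ u_j^d,\qquad \sum_{j=1}^{r^{d-1}}|\sigma_j|\le (r\sqrt r)^{d-1}\alpha ;$$ and if $\alpha\le 1$, there are vectors $u_j^k\in\mathbb R^{N_k}$ such that $$T=\sum_{j=1}^{r^{d-1}}u_j^1\circ\cdots\circ u_j^d,\qquad \sum_{j=1}^{r^{d-1}}\big(u_j^k(t)\big)^2\le r^{d-1}\quad\text{for all }1\le k\le d,\ 1\le t\le N_k .$$ -/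

import Mathlib

noncomputable section

namespace RealTensor

/-- Real tensors of order `d` and size `N 0 × ⋯ × N (d - 1)`, given by their entries. As a finite
product of copies of `ℝ`, this type carries Mathlib's sup norm, so that `‖T‖` is the entrywise
infinity norm of `T`. -/
abbrev Tensor {d : ℕ} (N : Fin d → ℕ) : Type :=
  ((k : Fin d) → Fin (N k)) → ℝ

variable {d : ℕ} {N : Fin d → ℕ}

/-- The outer product `u₁ ∘ ⋯ ∘ u_d` of vectors. -/
def outerVec (u : (k : Fin d) → Fin (N k) → ℝ) : Tensor N :=
  fun i => ∏ k, u k (i k)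

/-- The outer product `U₁ ∘ ⋯ ∘ U_d` of factor matrices with `K` columns each. -/
def outerMat {K : ℕ} (U : (k : Fin d) → Matrix (Fin (N k)) (Fin K) ℝ) : Tensor N :=
  fun i => ∑ j, ∏ k, U k (i k) j

/-- Unit tensors: outer products of vectors of Euclidean norm one. -/
def IsUnitTensor (T : Tensor N) : Prop :=
  ∃ u : (k : Fin d) → EuclideanSpace ℝ (Fin (N k)),
    (∀ k, ‖u k‖ = 1) ∧ T = outerVec fun k t => u k t

/-- The (CP) rank: the least number `r` such that `T` is a sum of `r` scalar multiples of unit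
tensors. -/
def rank (T : Tensor N) : ℕ :=
  sInf {r : ℕ | ∃ (c : Fin r → ℝ) (V : Fin r → Tensor N),
    (∀ j, IsUnitTensor (V j)) ∧ T = ∑ j, c j • V j}

/-- The rank-one sign tensors. -/
def signTensors (N : Fin d → ℕ) : Set (Tensor N) :=
  {T | (∀ i, T i = 1 ∨ T i = -1) ∧ rank T = 1}

/-- The atomic M-norm, `inf {t > 0 : T ∈ t • conv (rank-one sign tensors)}`. -/
def mNorm (T : Tensor N) : ℝ :=
  gauge (convexHull ℝ (signTensors N)) T

/-- `‖U‖_{2,∞} = sup {‖U x‖_∞ : ‖x‖₂ = 1}`; the outer norm is the sup norm on `Fin n → ℝ`. -/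
def twoInfNorm {n K : ℕ} (U : Matrix (Fin n) (Fin K) ℝ) : ℝ :=
  sSup {s : ℝ | ∃ x : EuclideanSpace ℝ (Fin K), ‖x‖ = 1 ∧ s = ‖U.mulVec fun j => x j‖}

/-- The max-qnorm: the infimum of `∏ k, ‖U k‖_{2,∞}` over all factorizations of `T`, with any
number of columns. -/
def maxQNorm (T : Tensor N) : ℝ :=
  sInf {c : ℝ | ∃ (K : ℕ) (U : (k : Fin d) → Matrix (Fin (N k)) (Fin K) ℝ),
    T = outerMat U ∧ c = ∏ k, twoInfNorm (U k)}

end RealTensor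

end

/-!
A tensor `T` of rank `r` satisfies all the upper bounds because of one decomposition
(`exists_bounded_decomposition`): `T` is a sum of `r ^ (d - 1)` outer products of vectors with
entries in `[-1, 1]`, except in one chosen mode, where the entries are bounded by `‖T‖`.

To obtain it, fix a mode `k`. The mode-`k` slices of `T` span a space of dimension at most `r`.
Among these slices choose a basis of that space maximising the absolute value of the determinant;
by Cramer's rule every slice is a combination of the chosen ones with coefficients in `[-1, 1]`
(`exists_bounded_coeff_of_finrank_le`). Since the chosen slices are slices of `T` itself, the same
step applies in every other mode without any loss in the size of the entries. After all modes but
one, what is left is a fibre of `T` in the remaining mode, whose entries are entries of `T`.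

Reading the decomposition in different ways gives the bounds. An outer product of vectors with
entries in `[-1, 1]` is in the convex hull of the rank-one sign tensors
(`outerVec_mem_convexHull_signTensors`), so the M-norm is at most `r ^ (d - 1) * ‖T‖`, which is
stronger than `(r * √r) ^ (d - 1) * ‖T‖`. As factor matrices with `r ^ (d - 1)` columns, all the
factors have rows of Euclidean norm at most `√(r ^ (d - 1))`, with an extra factor `‖T‖` in one
mode, and the product over the `d` modes is `√(r ^ (d ^ 2 - d)) * ‖T‖`.

The lower bounds hold because the sign tensors lie in the unit ball of the sup norm and, for the
max-qnorm, by Hölder's inequality (`norm_outerMat_le`), which needs `d ≥ 2`.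
-/

namespace RealTensor

/-! ### Maximal-volume subfamilies -/

/-- Every vector of a finite family in a space of dimension at most `r` is a combination, with
coefficients in `[-1, 1]`, of `r` fixed members of the family: the members are chosen to maximise
the absolute value of a determinant, and the coefficients are ratios of determinants. -/
theorem exists_bounded_coeff_of_finrank_le {ι E : Type*} [Finite ι] [Nonempty ι]
    [AddCommGroup E] [Module ℝ E] (v : ι → E) (r : ℕ)
    (hr : Module.finrank ℝ (Submodule.span ℝ (Set.range v)) ≤ r) :
    ∃ (p : Fin r → ι) (C : ι → Fin r → ℝ), (∀ i a, |C i a| ≤ 1) ∧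
      ∀ i, v i = ∑ a, C i a • v (p a) := by
  classical
  set W := Submodule.span ℝ (Set.range v)
  have : FiniteDimensional ℝ W := FiniteDimensional.span_of_finite ℝ (Set.finite_range v)
  let w : ι → W := fun i => ⟨v i, Submodule.subset_span ⟨i, rfl⟩⟩
  have hw : Submodule.span ℝ (Set.range w) = ⊤ := by
    have := Submodule.span_span_coe_preimage (R := ℝ) (s := Set.range v)
    rw [← this]
    congr 1
    ext x
    constructor
    · rintro ⟨i, rfl⟩
      exact ⟨i, rfl⟩
    · rintro ⟨i, hi⟩
      exact ⟨i, Subtype.ext hi⟩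
  let s := Module.finrank ℝ W
  let b : Module.Basis (Fin s) ℝ W := Module.finBasis ℝ W
  obtain ⟨p, hp⟩ := Finite.exists_max fun p : Fin s → ι => |b.det (w ∘ p)|
  -- Some subfamily is a basis, so that the maximum is not zero.
  have hne : b.det (w ∘ p) ≠ 0 := by
    have hs : Module.finrank ℝ (Submodule.span ℝ (Set.range w)) = s := by rw [hw, finrank_top]
    obtain ⟨f, hf, -, hfi⟩ := Submodule.exists_fun_fin_finrank_span_eq ℝ (Set.range w)
    choose q hq using fun a : Fin s => hf (Fin.cast hs.symm a)
    have hq' : w ∘ q = f ∘ Fin.cast hs.symm := funext hq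
    have hli : LinearIndependent ℝ (w ∘ q) := hq' ▸ hfi.comp _ (Fin.cast_injective _)
    have hunit := (Module.Basis.is_basis_iff_det b).1
      ⟨hli, hli.span_eq_top_of_card_eq_finrank' (by simp [s])⟩
    intro h0
    have h1 := hp q
    simp only [h0, abs_zero, abs_nonpos_iff] at h1
    exact hunit.ne_zero h1
  obtain ⟨hli, hsp⟩ := (Module.Basis.is_basis_iff_det b).2 (isUnit_iff_ne_zero.2 hne)
  let e := Module.Basis.mk hli hsp.ge
  have hcoef : ∀ i a, |e.repr (w i) a| ≤ 1 := by
    intro i a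
    have h := congrArg (fun φ => φ (w i)) (b.det_smul_mk_coord_eq_det_update hli hsp.ge a)
    have h2 : b.det (w ∘ p) * e.repr (w i) a = b.det (w ∘ Function.update p a i) := by
      rw [Function.comp_update]
      simpa [e] using h
    have h3 := hp (Function.update p a i)
    rw [← h2, abs_mul] at h3
    exact le_of_mul_le_mul_left (by simpa using h3) (abs_pos.2 hne)
  -- If the dimension is less than `r`, the list is padded with zero coefficients.
  refine ⟨fun a => if h : (a : ℕ) < s then p ⟨a, h⟩ else Classical.arbitrary ι,
    fun i a => if h : (a : ℕ) < s then e.repr (w i) ⟨a, h⟩ else 0, ?_, ?_⟩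
  · intro i a
    dsimp only
    split_ifs
    · exact hcoef _ _
    · simp
  · intro i
    have h := congrArg W.subtype (e.sum_repr (w i))
    simp only [map_sum, map_smul] at h
    refine h.symm.trans (Fintype.sum_of_injective (Fin.castLE hr) (Fin.castLE_injective hr) _ _
      ?_ ?_)
    · intro a ha
      have hlt : ¬ (a : ℕ) < s := fun hlt => ha ⟨⟨a, hlt⟩, rfl⟩
      simp [hlt]
    · intro a
      have hlt : (a : ℕ) < s := a.2
      simp [e, w, hlt]

/-! ### Outer products and rank -/

variable {d : ℕ} {N : Fin d → ℕ}

/-- One factor of an outer product split off from the others. -/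
theorem outerVec_eq_mul_prod_erase (u : (k : Fin d) → Fin (N k) → ℝ) (k : Fin d)
    (i : (k : Fin d) → Fin (N k)) :
    outerVec u i = u k (i k) * ∏ l ∈ Finset.univ.erase k, u l (i l) :=
  (Finset.mul_prod_erase _ _ (Finset.mem_univ k)).symm

theorem outerVec_update (u : (k : Fin d) → Fin (N k) → ℝ) (k : Fin d) (x : Fin (N k) → ℝ)
    (i : (k : Fin d) → Fin (N k)) :
    outerVec (Function.update u k x) i = x (i k) * ∏ l ∈ Finset.univ.erase k, u l (i l) := by
  rw [outerVec_eq_mul_prod_erase _ k, Function.update_self]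
  congr 1
  refine Finset.prod_congr rfl fun l hl => ?_
  rw [Function.update_of_ne (Finset.ne_of_mem_erase hl)]

theorem outerVec_smul_family (c : Fin d → ℝ) (u : (k : Fin d) → Fin (N k) → ℝ) :
    outerVec (fun k => c k • u k) = (∏ k, c k) • outerVec u := by
  ext i
  simp [outerVec, Finset.prod_mul_distrib]

/-- The tensors supported on one entry are unit tensors, so that the set of lengths of
decompositions into unit tensors is never empty and `rank` is attained. -/
theorem exists_rank_decomposition (T : Tensor N) :
    ∃ (c : Fin (rank T) → ℝ) (V : Fin (rank T) → Tensor N),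
      (∀ j, IsUnitTensor (V j)) ∧ T = ∑ j, c j • V j := by
  classical
  refine Nat.sInf_mem (s := {r : ℕ | ∃ (c : Fin r → ℝ) (V : Fin r → Tensor N),
    (∀ j, IsUnitTensor (V j)) ∧ T = ∑ j, c j • V j}) ?_
  let ε := (Fintype.equivFin ((k : Fin d) → Fin (N k))).symm
  refine ⟨_, fun j => T (ε j), fun j => outerVec fun k => Pi.single (ε j k) 1, fun j => ?_, ?_⟩
  · refine ⟨fun k => EuclideanSpace.single (ε j k) 1, fun k => by simp, ?_⟩
    congr 1
  · ext i
    rw [ε.sum_comp (fun e => T e • outerVec fun k => Pi.single (e k) (1 : ℝ)), Finset.sum_apply,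
      Finset.sum_eq_single i]
    · simp [outerVec]
    · intro e _ he
      obtain ⟨k, hk⟩ := Function.ne_iff.1 he
      have : outerVec (fun k => Pi.single (e k) (1 : ℝ)) i = 0 :=
        Finset.prod_eq_zero (Finset.mem_univ k) (by simp [hk.symm])
      simp [this]
    · simp

/-- An outer product of vectors with entries `±1` has rank one: it is not zero, and dividing each
factor by its Euclidean norm exhibits it as a multiple of a unit tensor. -/
theorem outerVec_mem_signTensors (hN : ∀ k, 1 ≤ N k) (u : (k : Fin d) → Fin (N k) → ℝ)
    (hu : ∀ k t, u k t = 1 ∨ u k t = -1) : outerVec u ∈ signTensors N := by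
  have hsign : ∀ i, outerVec u i = 1 ∨ outerVec u i = -1 := by
    intro i
    refine Finset.prod_induction (fun k => u k (i k)) (fun x => x = 1 ∨ x = -1) ?_ (by simp)
      fun k _ => hu k _
    rintro a b (rfl | rfl) (rfl | rfl) <;> simp
  refine ⟨hsign, le_antisymm ?_ ?_⟩
  · let w : (k : Fin d) → EuclideanSpace ℝ (Fin (N k)) := fun k => WithLp.toLp 2 (u k)
    have hw : ∀ k, ‖w k‖ ≠ 0 := by
      intro k h
      have h0 : u k ⟨0, hN k⟩ = 0 := congrFun (congrArg WithLp.ofLp (norm_eq_zero.1 h)) _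
      rcases hu k ⟨0, hN k⟩ with h | h <;> rw [h] at h0 <;> norm_num at h0
    refine Nat.sInf_le ⟨fun _ => ∏ k, ‖w k‖, fun _ => outerVec fun k t => (‖w k‖⁻¹ • w k) t,
      fun _ => ⟨fun k => ‖w k‖⁻¹ • w k, fun k => ?_, rfl⟩, ?_⟩
    · rw [norm_smul, norm_inv, norm_norm, inv_mul_cancel₀ (hw k)]
    · rw [Fin.sum_univ_one, ← outerVec_smul_family]
      congr 1
      ext k t
      simp [w, mul_inv_cancel_left₀ (hw k)]
  · rw [Nat.one_le_iff_ne_zero]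
    intro h0
    obtain ⟨c, V, -, hT⟩ := exists_rank_decomposition (outerVec u)
    revert c V
    rw [h0]
    intro c V hT
    have := hsign fun k => ⟨0, hN k⟩
    rw [hT] at this
    simp at this

/-! ### The decomposition into `r ^ (d - 1)` outer products -/

/-- Each mode-`k` slice of a rank-`r` tensor is a combination, with coefficients in `[-1, 1]`, of
`r` fixed mode-`k` slices, because these slices span a space of dimension at most `r`. -/
theorem exists_slice_decomposition (hN : ∀ k, 1 ≤ N k) (T : Tensor N) (k : Fin d) :
    ∃ (p : Fin (rank T) → Fin (N k)) (C : Fin (N k) → Fin (rank T) → ℝ),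
      (∀ t a, |C t a| ≤ 1) ∧
      ∀ i, T i = ∑ a, C (i k) a * T (Function.update i k (p a)) := by
  obtain ⟨c, V, hV, hT⟩ := exists_rank_decomposition T
  choose w _ hw using hV
  let v : Fin (N k) → Tensor N := fun t i => T (Function.update i k t)
  let z : Fin (rank T) → Tensor N := fun j i => c j * ∏ l ∈ Finset.univ.erase k, w j l (i l)
  have hv : ∀ t, v t = ∑ j, w j k t • z j := by
    intro t
    ext i
    have : T (Function.update i k t) = (∑ j, c j • V j) (Function.update i k t) :=
      congrFun hT _
    simp only [v, this, Finset.sum_apply, Pi.smul_apply, smul_eq_mul, z]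
    refine Finset.sum_congr rfl fun j _ => ?_
    rw [hw j, outerVec_eq_mul_prod_erase _ k, Function.update_self, mul_left_comm]
    congr 2
    refine Finset.prod_congr rfl fun l hl => ?_
    rw [Function.update_of_ne (Finset.ne_of_mem_erase hl)]
  have hfr : Module.finrank ℝ (Submodule.span ℝ (Set.range v)) ≤ rank T := by
    have hle : Submodule.span ℝ (Set.range v) ≤ Submodule.span ℝ (Set.range z) := by
      rw [Submodule.span_le]
      rintro _ ⟨t, rfl⟩
      rw [hv t]
      exact Submodule.sum_mem _ fun j _ => Submodule.smul_mem _ _ (Submodule.subset_span ⟨j, rfl⟩)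
    refine (Submodule.finrank_mono hle).trans ?_
    simpa [Set.finrank] using finrank_range_le_card (R := ℝ) z
  have : Nonempty (Fin (N k)) := ⟨⟨0, hN k⟩⟩
  obtain ⟨p, C, hC, h⟩ := exists_bounded_coeff_of_finrank_le v _ hfr
  refine ⟨p, C, hC, fun i => ?_⟩
  have := congrFun (h (i k)) i
  simpa [v] using this

/-- The slice decomposition applied to every mode in `s`. -/
theorem exists_multislice_decomposition (hN : ∀ k, 1 ≤ N k) (T : Tensor N) (s : Finset (Fin d)) :
    ∃ (f : Fin (rank T ^ s.card) → (k : Fin d) → Fin (N k) → ℝ)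
      (q : Fin (rank T ^ s.card) → (k : Fin d) → Fin (N k)),
      (∀ j k t, |f j k t| ≤ 1) ∧
      ∀ i, T i = ∑ j, (∏ k ∈ s, f j k (i k)) * T (s.piecewise (q j) i) := by
  classical
  induction s using Finset.induction_on with
  | empty =>
    refine ⟨fun _ _ _ => 1, fun _ k => ⟨0, hN k⟩, by simp, fun i => ?_⟩
    simp only [Finset.prod_empty, one_mul, Finset.piecewise_empty, Finset.sum_const,
      Finset.card_fin]
    rw [Finset.card_empty, pow_zero, one_smul]
  | insert k s hk ih =>
    obtain ⟨f, q, hf, h⟩ := ih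
    obtain ⟨p, C, hC, hT⟩ := exists_slice_decomposition hN T k
    let ε : Fin (rank T ^ (insert k s).card) ≃ Fin (rank T ^ s.card) × Fin (rank T) :=
      (finCongr (by rw [Finset.card_insert_of_notMem hk, pow_succ])).trans finProdFinEquiv.symm
    refine ⟨fun j => Function.update (f (ε j).1) k fun t => C t (ε j).2,
      fun j => Function.update (q (ε j).1) k (p (ε j).2), ?_, ?_⟩
    · intro j l t
      rcases eq_or_ne l k with rfl | hl
      · simpa using hC _ _
      · simpa [hl] using hf _ _ _
    · intro i
      rw [ε.sum_comp (fun x => (∏ l ∈ insert k s,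
          Function.update (f x.1) k (fun t => C t x.2) l (i l)) *
        T ((insert k s).piecewise (Function.update (q x.1) k (p x.2)) i)),
        Fintype.sum_prod_type, h i]
      refine Finset.sum_congr rfl fun j _ => ?_
      rw [hT (s.piecewise (q j) i), Finset.mul_sum]
      refine Finset.sum_congr rfl fun a _ => ?_
      rw [Finset.prod_insert hk, Finset.piecewise_insert, Finset.piecewise_eq_of_notMem _ _ _ hk]
      have h1 : ∏ l ∈ s, Function.update (f j) k (fun t => C t a) l (i l) =
          ∏ l ∈ s, f j l (i l) := by
        refine Finset.prod_congr rfl fun l hl => ?_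
        rw [Function.update_of_ne (ne_of_mem_of_not_mem hl hk)]
      have h2 : s.piecewise (Function.update (q j) k (p a)) i = s.piecewise (q j) i := by
        ext1 l
        by_cases hl : l ∈ s
        · simp [hl, ne_of_mem_of_not_mem hl hk]
        · simp [hl]
      rw [h1, h2, Function.update_self, Function.update_self]
      ring

/-- A tensor of rank `r` is a sum of `r ^ (d - 1)` outer products of vectors whose entries are
bounded by `1`, except in one prescribed mode `k₀`, where they are bounded by `‖T‖`: the vectors in
mode `k₀` are fibres of `T`. -/
theorem exists_bounded_decomposition (hN : ∀ k, 1 ≤ N k) (T : Tensor N) (k₀ : Fin d) :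
    ∃ u : Fin (rank T ^ (d - 1)) → (k : Fin d) → Fin (N k) → ℝ,
      T = ∑ j, outerVec (u j) ∧ (∀ j, ∀ k ≠ k₀, ∀ t, |u j k t| ≤ 1) ∧
      ∀ j t, |u j k₀ t| ≤ ‖T‖ := by
  classical
  have hcard : (Finset.univ.erase k₀).card = d - 1 := by simp
  rw [← hcard]
  obtain ⟨f, q, hf, h⟩ := exists_multislice_decomposition hN T (Finset.univ.erase k₀)
  refine ⟨fun j => Function.update (f j) k₀ fun t => T (Function.update (q j) k₀ t), ?_, ?_, ?_⟩
  · ext i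
    rw [h i, Finset.sum_apply]
    refine Finset.sum_congr rfl fun j _ => ?_
    rw [outerVec_update, mul_comm]
    congr 2
    ext1 l
    rcases eq_or_ne l k₀ with rfl | hl
    · simp
    · simp [hl]
  · intro j k hk t
    simpa [hk] using hf j k t
  · intro j t
    simpa using norm_le_pi_norm T (Function.update (q j) k₀ t)

/-! ### The M-norm -/

open scoped Pointwise

/-- The vectors with entries in `[-1, 1]` form the convex hull of the sign vectors; replacing the
factors of an outer product one at a time, linearity in each factor gives the claim. -/
theorem outerVec_mem_convexHull_signTensors (hN : ∀ k, 1 ≤ N k)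
    (u : (k : Fin d) → Fin (N k) → ℝ) (hu : ∀ k t, |u k t| ≤ 1) :
    outerVec u ∈ convexHull ℝ (signTensors N) := by
  classical
  suffices H : ∀ (s : Finset (Fin d)) (u : (k : Fin d) → Fin (N k) → ℝ),
      (∀ k ∈ s, ∀ t, |u k t| ≤ 1) → (∀ k ∉ s, ∀ t, u k t = 1 ∨ u k t = -1) →
      outerVec u ∈ convexHull ℝ (signTensors N) from
    H Finset.univ u (fun k _ => hu k) (by simp)
  intro s
  induction s using Finset.induction_on with
  | empty =>
    intro u _ hu
    exact subset_convexHull _ _ (outerVec_mem_signTensors hN u fun k => hu k (by simp))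
  | insert k s hk ih =>
    intro u hu hu'
    have hlin : IsLinearMap ℝ fun x : Fin (N k) → ℝ => outerVec (Function.update u k x) := by
      constructor
      · intro x y
        ext i
        simp only [outerVec_update, Pi.add_apply, add_mul]
      · intro c x
        ext i
        simp only [outerVec_update, Pi.smul_apply, smul_eq_mul, mul_assoc]
    have hsub : convexHull ℝ (Set.univ.pi fun _ : Fin (N k) => ({1, -1} : Set ℝ)) ⊆
        (fun x => outerVec (Function.update u k x)) ⁻¹' convexHull ℝ (signTensors N) := by
      refine convexHull_min (fun x hx => ?_) ((convex_convexHull ℝ _).is_linear_preimage hlin)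
      refine ih _ (fun l hl t => ?_) fun l hl t => ?_
      · rw [Function.update_of_ne (ne_of_mem_of_not_mem hl hk)]
        exact hu l (Finset.mem_insert_of_mem hl) t
      · rcases eq_or_ne l k with rfl | hlk
        · rw [Function.update_self]
          simpa using hx t (Set.mem_univ t)
        · rw [Function.update_of_ne hlk]
          exact hu' l (by simp [hl, hlk]) t
    have hmem : u k ∈ convexHull ℝ (Set.univ.pi fun _ : Fin (N k) => ({1, -1} : Set ℝ)) := by
      rw [convexHull_pi]
      intro t _
      have := abs_le.1 (hu k (Finset.mem_insert_self k s) t)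
      rw [convexHull_pair, segment_symm, segment_eq_Icc (by norm_num)]
      exact this
    simpa using hsub hmem

/-- The sign tensors lie in the closed unit ball of the sup norm, and hence so does their hull. -/
theorem norm_le_of_mem_smul_convexHull {T : Tensor N} {t : ℝ} (ht : 0 ≤ t)
    (hT : T ∈ t • convexHull ℝ (signTensors N)) : ‖T‖ ≤ t := by
  have hsub : convexHull ℝ (signTensors N) ⊆ Metric.closedBall 0 1 := by
    refine convexHull_min (fun X hX => ?_) (convex_closedBall _ _)
    rw [mem_closedBall_zero_iff, pi_norm_le_iff_of_nonneg zero_le_one]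
    intro i
    rcases hX.1 i with h | h <;> simp [h]
  obtain ⟨X, hX, rfl⟩ := hT
  have := mem_closedBall_zero_iff.1 (hsub hX)
  simp only [norm_smul, Real.norm_of_nonneg ht]
  exact mul_le_of_le_one_right ht this

/-- A nonzero tensor of rank `r` lies in `r ^ (d - 1) * ‖T‖` times the hull of the sign tensors:
scaling the mode with bound `‖T‖` makes the bounded decomposition an average of outer products of
vectors with entries in `[-1, 1]`. -/
theorem mem_smul_convexHull_signTensors (hd : 0 < d) (hN : ∀ k, 1 ≤ N k) (T : Tensor N)
    (hT : T ≠ 0) :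
    T ∈ ((rank T : ℝ) ^ (d - 1) * ‖T‖) • convexHull ℝ (signTensors N) := by
  classical
  let k₀ : Fin d := ⟨0, hd⟩
  obtain ⟨u, h, hu, hu₀⟩ := exists_bounded_decomposition hN T k₀
  have hpos : 0 < ‖T‖ := norm_pos_iff.2 hT
  have hn : (rank T ^ (d - 1) : ℕ) ≠ 0 := by
    intro h0
    apply hT
    rw [h]
    have : IsEmpty (Fin (rank T ^ (d - 1))) := by rw [h0]; infer_instance
    simp
  have hn' : ((rank T : ℝ) ^ (d - 1)) ≠ 0 := by exact_mod_cast hn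
  let w : Fin (rank T ^ (d - 1)) → (k : Fin d) → Fin (N k) → ℝ :=
    fun j => Function.update (u j) k₀ (‖T‖⁻¹ • u j k₀)
  have hw : ∀ j, outerVec (u j) = ‖T‖ • outerVec (w j) := by
    intro j
    ext i
    rw [Pi.smul_apply, outerVec_update, outerVec_eq_mul_prod_erase _ k₀, smul_eq_mul,
      Pi.smul_apply, smul_eq_mul, ← mul_assoc, mul_inv_cancel_left₀ hpos.ne']
  refine ⟨∑ j, ((rank T : ℝ) ^ (d - 1))⁻¹ • outerVec (w j), ?_, ?_⟩
  · refine (convex_convexHull ℝ _).sum_mem (fun _ _ => by positivity) ?_ fun j _ => ?_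
    · simp [hn']
    · refine outerVec_mem_convexHull_signTensors hN _ fun k t => ?_
      rcases eq_or_ne k k₀ with rfl | hk
      · simp only [w, Function.update_self, Pi.smul_apply, smul_eq_mul, abs_mul, abs_inv, abs_norm]
        exact inv_mul_le_one_of_le₀ (hu₀ j t) hpos.le
      · simpa [w, hk] using hu j k hk t
  · conv_rhs => rw [h]
    simp only [hw, ← Finset.smul_sum, smul_smul]
    congr 1
    field_simp

/-- The membership shown for the upper bound is needed here too: the infimum defining the gauge
would be `0` if `T` were in no multiple of the convex hull. -/
theorem norm_le_mNorm (hd : 0 < d) (hN : ∀ k, 1 ≤ N k) (T : Tensor N) : ‖T‖ ≤ mNorm T := by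
  rcases eq_or_ne T 0 with rfl | hT
  · rw [norm_zero]
    exact gauge_nonneg _
  · have hmem := mem_smul_convexHull_signTensors hd hN T hT
    have hpos : 0 < (rank T : ℝ) ^ (d - 1) * ‖T‖ :=
      (norm_pos_iff.2 hT).trans_le (norm_le_of_mem_smul_convexHull (by positivity) hmem)
    exact le_csInf ⟨_, hpos, hmem⟩ fun t ht => norm_le_of_mem_smul_convexHull ht.1.le ht.2

theorem mNorm_le (hd : 0 < d) (hN : ∀ k, 1 ≤ N k) (T : Tensor N) :
    mNorm T ≤ (rank T : ℝ) ^ (d - 1) * ‖T‖ := by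
  rcases eq_or_ne T 0 with rfl | hT
  · simp [mNorm]
  · exact gauge_le_of_mem (by positivity) (mem_smul_convexHull_signTensors hd hN T hT)

/-! ### The max-qnorm -/

theorem twoInfNorm_nonneg {n K : ℕ} (U : Matrix (Fin n) (Fin K) ℝ) : 0 ≤ twoInfNorm U := by
  refine Real.sSup_nonneg ?_
  rintro _ ⟨x, -, rfl⟩
  exact norm_nonneg _

/-- By Cauchy-Schwarz, a bound for the Euclidean norms of the rows bounds every element of the set
whose supremum is `twoInfNorm U`. -/
theorem norm_mulVec_le_of_row_le {n K : ℕ} {U : Matrix (Fin n) (Fin K) ℝ} {B : ℝ} (hB : 0 ≤ B)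
    (hU : ∀ t, ∑ j, U t j ^ 2 ≤ B ^ 2) {x : EuclideanSpace ℝ (Fin K)} (hx : ‖x‖ = 1) :
    ‖U.mulVec fun j => x j‖ ≤ B := by
  rw [pi_norm_le_iff_of_nonneg hB]
  intro t
  have hx' : ∑ j, x j ^ 2 = 1 := by rw [← EuclideanSpace.real_norm_sq_eq, hx, one_pow]
  refine abs_le_of_sq_le_sq ?_ hB
  refine (Finset.sum_mul_sq_le_sq_mul_sq Finset.univ (U t) fun j => x j).trans ?_
  rw [hx', mul_one]
  exact hU t

theorem twoInfNorm_le {n K : ℕ} {U : Matrix (Fin n) (Fin K) ℝ} {B : ℝ} (hB : 0 ≤ B)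
    (hU : ∀ t, ∑ j, U t j ^ 2 ≤ B ^ 2) : twoInfNorm U ≤ B := by
  refine Real.sSup_le ?_ hB
  rintro _ ⟨x, hx, rfl⟩
  exact norm_mulVec_le_of_row_le hB hU hx

/-- The Euclidean norm of each row is attained at the normalised row. -/
theorem sum_row_sq_le_twoInfNorm_sq {n K : ℕ} (U : Matrix (Fin n) (Fin K) ℝ) (t : Fin n) :
    ∑ j, U t j ^ 2 ≤ twoInfNorm U ^ 2 := by
  let y : EuclideanSpace ℝ (Fin K) := WithLp.toLp 2 (U t)
  have hy : ∑ j, U t j ^ 2 = ‖y‖ ^ 2 := (EuclideanSpace.real_norm_sq_eq y).symm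
  rcases eq_or_ne ‖y‖ 0 with h0 | h0
  · rw [hy, h0]
    nlinarith [twoInfNorm_nonneg U]
  · rw [hy]
    refine pow_le_pow_left₀ (norm_nonneg y) ?_ 2
    have hbdd : BddAbove {s : ℝ | ∃ x : EuclideanSpace ℝ (Fin K), ‖x‖ = 1 ∧
        s = ‖U.mulVec fun j => x j‖} := by
      refine ⟨√(∑ t, ∑ j, U t j ^ 2), ?_⟩
      rintro _ ⟨x, hx, rfl⟩
      refine norm_mulVec_le_of_row_le (Real.sqrt_nonneg _) (fun t => ?_) hx
      rw [Real.sq_sqrt (by positivity)]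
      exact Finset.single_le_sum (f := fun t => ∑ j, U t j ^ 2) (fun _ _ => by positivity)
        (Finset.mem_univ t)
    have hunit : ‖‖y‖⁻¹ • y‖ = 1 := by
      rw [norm_smul, norm_inv, norm_norm, inv_mul_cancel₀ h0]
    refine le_trans ?_ (le_csSup hbdd ⟨‖y‖⁻¹ • y, hunit, rfl⟩)
    refine le_trans ?_ (norm_le_pi_norm _ t)
    have : (U.mulVec fun j => (‖y‖⁻¹ • y) j) t = ‖y‖ := by
      have h1 : (U.mulVec fun j => (‖y‖⁻¹ • y) j) t = ‖y‖⁻¹ * ∑ j, U t j ^ 2 := by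
        simp only [Matrix.mulVec, dotProduct, Finset.mul_sum, PiLp.smul_apply, smul_eq_mul, y]
        exact Finset.sum_congr rfl fun j _ => by ring
      rw [h1, hy, sq, inv_mul_cancel_left₀ h0]
    rw [this]
    exact le_abs_self _

/-- For nonnegative families, a sum of products over a nonempty index set is at most the product of
the sums. -/
theorem sum_prod_le_prod_sum {κ J : Type*} [Fintype J] {s : Finset κ} (hs : s.Nonempty)
    (x : κ → J → ℝ) (hx : ∀ k j, 0 ≤ x k j) :
    ∑ j, ∏ k ∈ s, x k j ≤ ∏ k ∈ s, ∑ j, x k j := by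
  classical
  induction hs using Finset.Nonempty.cons_induction with
  | singleton k => simp
  | cons k s hk hs ih =>
    simp only [Finset.prod_cons]
    calc ∑ j, x k j * ∏ l ∈ s, x l j
        ≤ ∑ j, (∑ i, x k i) * ∏ l ∈ s, x l j := by
          refine Finset.sum_le_sum fun j _ => mul_le_mul_of_nonneg_right ?_
            (Finset.prod_nonneg fun l _ => hx l j)
          exact Finset.single_le_sum (fun i _ => hx k i) (Finset.mem_univ j)
      _ = (∑ i, x k i) * ∑ j, ∏ l ∈ s, x l j := (Finset.mul_sum ..).symm
      _ ≤ _ := mul_le_mul_of_nonneg_left ih (Finset.sum_nonneg fun i _ => hx k i)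

/-- Hölder's inequality for `d ≥ 2` rows, each measured in the Euclidean norm. -/
theorem norm_outerMat_le (hd : 2 ≤ d) {K : ℕ} (U : (k : Fin d) → Matrix (Fin (N k)) (Fin K) ℝ) :
    ‖outerMat U‖ ≤ ∏ k, twoInfNorm (U k) := by
  have hnn : 0 ≤ ∏ k, twoInfNorm (U k) := Finset.prod_nonneg fun k _ => twoInfNorm_nonneg _
  rw [pi_norm_le_iff_of_nonneg hnn]
  intro i
  refine abs_le_of_sq_le_sq ?_ hnn
  let k₀ : Fin d := ⟨0, by lia⟩
  have hne : (Finset.univ.erase k₀).Nonempty :=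
    ⟨⟨1, by lia⟩, by simp [k₀]⟩
  have hsplit : outerMat U i =
      ∑ j, U k₀ (i k₀) j * ∏ k ∈ Finset.univ.erase k₀, U k (i k) j :=
    Finset.sum_congr rfl fun j _ => (Finset.mul_prod_erase _ _ (Finset.mem_univ k₀)).symm
  calc outerMat U i ^ 2
      ≤ (∑ j, U k₀ (i k₀) j ^ 2) * ∑ j, (∏ k ∈ Finset.univ.erase k₀, U k (i k) j) ^ 2 := by
        rw [hsplit]
        exact Finset.sum_mul_sq_le_sq_mul_sq _ _ _
    _ ≤ (∑ j, U k₀ (i k₀) j ^ 2) * ∏ k ∈ Finset.univ.erase k₀, ∑ j, U k (i k) j ^ 2 := by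
        refine mul_le_mul_of_nonneg_left ?_ (by positivity)
        simp only [← Finset.prod_pow]
        exact sum_prod_le_prod_sum hne (fun k j => U k (i k) j ^ 2) fun _ _ => sq_nonneg _
    _ = ∏ k, ∑ j, U k (i k) j ^ 2 :=
        Finset.mul_prod_erase _ (fun k => ∑ j, U k (i k) j ^ 2) (Finset.mem_univ k₀)
    _ ≤ ∏ k, twoInfNorm (U k) ^ 2 :=
        Finset.prod_le_prod (fun _ _ => by positivity) fun k _ =>
          sum_row_sq_le_twoInfNorm_sq _ _
    _ = _ := Finset.prod_pow _ _ _

/-- The bounded decomposition, read as a factorization with `r ^ (d - 1)` columns. -/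
theorem exists_outerMat_factorization (hd : 0 < d) (hN : ∀ k, 1 ≤ N k) (T : Tensor N) :
    ∃ U : (k : Fin d) → Matrix (Fin (N k)) (Fin (rank T ^ (d - 1))) ℝ,
      T = outerMat U ∧ ∏ k, twoInfNorm (U k) ≤ √((rank T : ℝ) ^ (d ^ 2 - d)) * ‖T‖ := by
  classical
  let k₀ : Fin d := ⟨0, hd⟩
  obtain ⟨u, h, hu, hu₀⟩ := exists_bounded_decomposition hN T k₀
  refine ⟨fun k => Matrix.of fun t j => u j k t, ?_, ?_⟩
  · conv_lhs => rw [h]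
    ext i
    simp [outerMat, outerVec]
  · have hrow : ∀ (k : Fin d) (B : ℝ), 0 ≤ B → (∀ j t, |u j k t| ≤ B) →
        twoInfNorm (Matrix.of fun t j => u j k t) ≤ √((rank T : ℝ) ^ (d - 1)) * B := by
      intro k B hB hk
      refine twoInfNorm_le (by positivity) fun t => ?_
      rw [mul_pow, Real.sq_sqrt (by positivity)]
      calc ∑ j, u j k t ^ 2 ≤ ∑ _j : Fin (rank T ^ (d - 1)), B ^ 2 :=
            Finset.sum_le_sum fun j _ => sq_le_sq.2 ((hk j t).trans (le_abs_self B))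
        _ = _ := by simp
    rw [← Finset.mul_prod_erase _ _ (Finset.mem_univ k₀)]
    calc _ ≤ (√((rank T : ℝ) ^ (d - 1)) * ‖T‖) *
          ∏ _k ∈ Finset.univ.erase k₀, (√((rank T : ℝ) ^ (d - 1)) * 1) := by
          refine mul_le_mul (hrow k₀ _ (norm_nonneg T) hu₀) ?_
            (Finset.prod_nonneg fun k _ => twoInfNorm_nonneg _) (by positivity)
          exact Finset.prod_le_prod (fun k _ => twoInfNorm_nonneg _) fun k hk =>
            hrow k 1 zero_le_one fun j t => hu j k (Finset.ne_of_mem_erase hk) t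
      _ = √((rank T : ℝ) ^ (d - 1)) ^ (d - 1 + 1) * ‖T‖ := by
          simp only [Finset.prod_const, mul_one, Finset.card_erase_of_mem (Finset.mem_univ k₀),
            Finset.card_univ, Fintype.card_fin]
          ring
      _ = √((rank T : ℝ) ^ (d ^ 2 - d)) * ‖T‖ := by
          have he : d ^ 2 - d = (d - 1) * d := by rw [sq, Nat.sub_mul, one_mul]
          rw [Nat.sub_add_cancel hd, he, pow_mul,
            Real.sqrt_eq_rpow, Real.sqrt_eq_rpow, Real.rpow_pow_comm (by positivity)]

theorem norm_le_maxQNorm (hd : 2 ≤ d) (hN : ∀ k, 1 ≤ N k) (T : Tensor N) :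
    ‖T‖ ≤ maxQNorm T := by
  obtain ⟨U, hU, -⟩ := exists_outerMat_factorization (by lia) hN T
  refine le_csInf ⟨_, _, U, hU, rfl⟩ ?_
  rintro _ ⟨K, W, hW, rfl⟩
  rw [hW]
  exact norm_outerMat_le hd W

theorem maxQNorm_le (hd : 0 < d) (hN : ∀ k, 1 ≤ N k) (T : Tensor N) :
    maxQNorm T ≤ √((rank T : ℝ) ^ (d ^ 2 - d)) * ‖T‖ := by
  obtain ⟨U, hU, hle⟩ := exists_outerMat_factorization hd hN T
  refine le_trans (csInf_le ⟨0, ?_⟩ ⟨_, U, hU, rfl⟩) hle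
  rintro _ ⟨K, U, -, rfl⟩
  exact Finset.prod_nonneg fun k _ => twoInfNorm_nonneg _

/-! ### Decompositions with normalised factors -/

theorem exists_norm_eq_one_and_eq_smul {n : ℕ} (hn : 1 ≤ n) (x : Fin n → ℝ) :
    ∃ y : Fin n → ℝ, ‖y‖ = 1 ∧ x = ‖x‖ • y := by
  rcases eq_or_ne x 0 with rfl | hx
  · have : Nonempty (Fin n) := ⟨⟨0, hn⟩⟩
    exact ⟨fun _ => 1, by simp [pi_norm_const], by simp⟩
  · exact ⟨‖x‖⁻¹ • x, by simp [norm_smul, hx], by simp [smul_smul, hx]⟩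

theorem exists_normalized_decomposition (hd : 0 < d) (hN : ∀ k, 1 ≤ N k) (T : Tensor N) :
    ∃ (σ : Fin (rank T ^ (d - 1)) → ℝ)
      (u : Fin (rank T ^ (d - 1)) → (k : Fin d) → Fin (N k) → ℝ),
      T = ∑ j, σ j • outerVec (u j) ∧ (∀ j k, ‖u j k‖ = 1) ∧
      ∑ j, |σ j| ≤ (rank T : ℝ) ^ (d - 1) * ‖T‖ := by
  obtain ⟨u, h, hu, hu₀⟩ := exists_bounded_decomposition hN T ⟨0, hd⟩
  choose y hy huy using fun j k => exists_norm_eq_one_and_eq_smul (hN k) (u j k)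
  refine ⟨fun j => ∏ k, ‖u j k‖, y, ?_, hy, ?_⟩
  · conv_lhs => rw [h]
    refine Finset.sum_congr rfl fun j _ => ?_
    rw [← outerVec_smul_family]
    exact congrArg _ (funext fun k => huy j k)
  · have hσ : ∀ j, |∏ k, ‖u j k‖| ≤ ‖T‖ := by
      intro j
      rw [abs_of_nonneg (by positivity),
        ← Finset.mul_prod_erase _ _ (Finset.mem_univ (⟨0, hd⟩ : Fin d))]
      refine (mul_le_of_le_one_right (norm_nonneg _) ?_).trans
        ((pi_norm_le_iff_of_nonneg (norm_nonneg _)).2 (hu₀ j))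
      exact Finset.prod_le_one (fun _ _ => norm_nonneg _) fun k hk =>
        (pi_norm_le_iff_of_nonneg zero_le_one).2 (hu j k (Finset.ne_of_mem_erase hk))
    simpa using Finset.sum_le_sum fun j (_ : j ∈ Finset.univ) => hσ j

theorem exists_decomposition_sum_sq_le (hd : 0 < d) (hN : ∀ k, 1 ≤ N k) (T : Tensor N)
    (hT : ‖T‖ ≤ 1) :
    ∃ u : Fin (rank T ^ (d - 1)) → (k : Fin d) → Fin (N k) → ℝ,
      T = ∑ j, outerVec (u j) ∧
      ∀ (k : Fin d) (t : Fin (N k)), ∑ j, (u j k t) ^ 2 ≤ (rank T : ℝ) ^ (d - 1) := by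
  obtain ⟨u, h, hu, hu₀⟩ := exists_bounded_decomposition hN T ⟨0, hd⟩
  refine ⟨u, h, fun k t => ?_⟩
  have hle : ∀ j, u j k t ^ 2 ≤ 1 := by
    intro j
    rw [sq_le_one_iff_abs_le_one]
    rcases eq_or_ne k ⟨0, hd⟩ with rfl | hk
    · exact (hu₀ j t).trans hT
    · exact hu j k hk t
  simpa using Finset.sum_le_sum fun j (_ : j ∈ Finset.univ) => hle j

theorem natCast_pow_le_mul_sqrt_pow (r n : ℕ) : (r : ℝ) ^ n ≤ ((r : ℝ) * √(r : ℝ)) ^ n := by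
  refine pow_le_pow_left₀ (Nat.cast_nonneg r) ?_ n
  rcases Nat.eq_zero_or_pos r with rfl | hr
  · simp
  · exact le_mul_of_one_le_right (Nat.cast_nonneg r) (Real.one_le_sqrt.2 (by exact_mod_cast hr))

end RealTensor
theorem mainTheorem5 (d : ℕ) (hd : 2 ≤ d) (N : Fin d → ℕ) (hN : ∀ k, 1 ≤ N k)
    (T : RealTensor.Tensor N) (r : ℕ) (hr : RealTensor.rank T = r)
    (α : ℝ) (hα : ‖T‖ = α) :
    (α ≤ RealTensor.mNorm T ∧
      RealTensor.mNorm T ≤ ((r : ℝ) * Real.sqrt (r : ℝ)) ^ (d - 1) * α) ∧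
    (α ≤ RealTensor.maxQNorm T ∧
      RealTensor.maxQNorm T ≤ Real.sqrt ((r : ℝ) ^ (d ^ 2 - d)) * α) ∧
    (∃ (σ : Fin (r ^ (d - 1)) → ℝ)
        (u : Fin (r ^ (d - 1)) → (k : Fin d) → Fin (N k) → ℝ),
      T = ∑ j, σ j • RealTensor.outerVec (u j) ∧
      (∀ j k, ‖u j k‖ = 1) ∧
      ∑ j, |σ j| ≤ ((r : ℝ) * Real.sqrt (r : ℝ)) ^ (d - 1) * α) ∧
    (α ≤ 1 → ∃ u : Fin (r ^ (d - 1)) → (k : Fin d) → Fin (N k) → ℝ,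
      T = ∑ j, RealTensor.outerVec (u j) ∧
      ∀ (k : Fin d) (t : Fin (N k)), ∑ j, (u j k t) ^ 2 ≤ (r : ℝ) ^ (d - 1)) := by
  subst hr hα
  have hd₀ : 0 < d := by lia
  have hle : (RealTensor.rank T : ℝ) ^ (d - 1) * ‖T‖ ≤
      ((RealTensor.rank T : ℝ) * Real.sqrt (RealTensor.rank T : ℝ)) ^ (d - 1) * ‖T‖ :=
    mul_le_mul_of_nonneg_right (RealTensor.natCast_pow_le_mul_sqrt_pow _ _) (norm_nonneg T)
  refine ⟨⟨RealTensor.norm_le_mNorm hd₀ hN T, (RealTensor.mNorm_le hd₀ hN T).trans hle⟩,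
    ⟨RealTensor.norm_le_maxQNorm hd hN T, RealTensor.maxQNorm_le hd₀ hN T⟩, ?_,
    RealTensor.exists_decomposition_sum_sq_le hd₀ hN T⟩
  obtain ⟨σ, u, h, hu, hσ⟩ := RealTensor.exists_normalized_decomposition hd₀ hN T
  exact ⟨σ, u, h, hu, hσ.trans hle⟩
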